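/- Let $n\in\mathbb N$ and let $p_1,\dots,p_n\in\mathbb C[s]=\mathbb C[s_1,\dots,s_n]$ be $n$ polynomials whose set of common zeros $p^{-1}(0)\subset\mathbb C^n$ is non-empty and finite. Let $(p)$ be the ideal of $\mathbb C[s]$ generated by $p_1,\dots,p_n$, and let $N(p)=\dim_{\mathbb C}\mathbb C[s]/(p)$. Fix a monomial order on $\mathbb C[s]$ and a (finite) Gröbner basis $\mathfrak G$ of $(p)$ for this order. Then there are exactly $N(p)$ monomials that do not lie in the monomial ideal generated by the leading monomials of the elements of $\mathfrak G$. Let $s^{\beta_0},\dots,s^{\beta_{N(p)-1}}$ be an enumeration, without repetition, of these monomials (whose classes form the Gröbner monomial basis of $\mathbb C[s]/(p)$). Let $U$ be an open subset of $\mathbb C^n$ that contains $p^{-1}(0)$, and let $f\in H(U)$, where $H(U)$ denotes the holomorphic functions on $U$. Then there is a unique $(\alpha_0[f],\dots,\alpha_{N(p)-1}[f])\in\mathbb C^{N(p)}$ such that the holomorphic function $$s\in U\longmapsto f(s)-\sum_{k=0}^{N(p)-1}\alpha_k[f]\,s^{\beta_k}$$ belongs locally to the ideal generated by $p_1,\dots,p_n$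 in $H(U)$; that is, every point of $U$ has an open neighbourhood $V\subset U$ on which this function equals $\sum_{j=1}^n g_j\,p_j$ for some $g_1,\dots,g_n\in H(V)$. -/

import Mathlib

/-- The common zero set of the polynomials `p 1, …, p n` in `ℂⁿ`. -/
def commonZeros {n : ℕ} (p : Fin n → MvPolynomial (Fin n) ℂ) : Set (Fin n → ℂ) :=
  {z | ∀ j, MvPolynomial.eval z (p j) = 0}

/-- The ideal `(p)` generated by `p 1, …, p n` in `ℂ[s]`. -/
noncomputable def polyIdeal {n : ℕ} (p : Fin n → MvPolynomial (Fin n) ℂ) : Ideal (MvPolynomial (Fin n) ℂ) :=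
  Ideal.span (Set.range p)

/-- `N(p)`, the dimension of the complex vector space `ℂ[s]/(p)`. -/
noncomputable def quotientDim {n : ℕ} (p : Fin n → MvPolynomial (Fin n) ℂ) : ℕ :=
  Module.finrank ℂ (MvPolynomial (Fin n) ℂ ⧸ polyIdeal p)

/-- `G` is a (finite) Gröbner basis of the ideal `I` for the monomial order `m`: it is contained
in `I`, and its leading terms generate the ideal generated by the leading terms of all elements
of `I`. -/
def IsGroebnerBasis {n : ℕ} (m : MonomialOrder (Fin n)) (I : Ideal (MvPolynomial (Fin n) ℂ))
    (G : Finset (MvPolynomial (Fin n) ℂ)) : Prop :=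
  (∀ g ∈ G, g ∈ I) ∧
    Ideal.span (m.leadingTerm '' (G : Set (MvPolynomial (Fin n) ℂ))) =
      Ideal.span (m.leadingTerm '' (I : Set (MvPolynomial (Fin n) ℂ)))

/-- The exponents of the monomials that do not belong to the monomial ideal generated by the
leading monomials of the elements of `G`. (Over a field the leading terms generate the same ideal
as the leading monomials; the leading term of the zero polynomial is zero.) -/
def standardExponents {n : ℕ} (m : MonomialOrder (Fin n))
    (G : Finset (MvPolynomial (Fin n) ℂ)) : Set (Fin n →₀ ℕ) :=
  {b | MvPolynomial.monomial b (1 : ℂ) ∉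
    Ideal.span (m.leadingTerm '' (G : Set (MvPolynomial (Fin n) ℂ)))}

/-- `h`, regarded as a function on the open set `U`, is holomorphic on `U` and belongs locally to
the ideal generated by `p 1, …, p n` in the holomorphic functions: every point of `U` has an open
neighbourhood `V ⊆ U` on which `h` is a combination of `p 1, …, p n` with coefficients
holomorphic on `V`. -/
def BelongsLocally {n : ℕ} (p : Fin n → MvPolynomial (Fin n) ℂ) (U : Set (Fin n → ℂ))
    (h : (Fin n → ℂ) → ℂ) : Prop :=
  DifferentiableOn ℂ h U ∧
    ∀ z ∈ U, ∃ V : Set (Fin n → ℂ), IsOpen V ∧ z ∈ V ∧ V ⊆ U ∧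
      ∃ g : Fin n → (Fin n → ℂ) → ℂ, (∀ j, DifferentiableOn ℂ (g j) V) ∧
        ∀ s ∈ V, h s = ∑ j, g j s * MvPolynomial.eval s (p j)

open Metric Set Filter Topology Function

/-! Write `O_z` for the ring of holomorphic germs at `z` and `m_z` for the maximal ideal of
polynomials vanishing at `z`. The heart of the matter is that `ℂ[s]/(p) → ∏ O_z/(p)O_z`, the product
running over the common zeros, is bijective. Away from the zeros some `p j` is invertible, so local
membership is a condition on the germs at the zeros only (`belongsLocally_iff`).

By the Nullstellensatz some intersection of the powers `m_z ^ (M + 1)` lies in `(p)`, and these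
powers are pairwise coprime. Freezing coordinates one at a time and dividing by `s i - z i` shows
that every germ is a polynomial modulo `m_z ^ M O_z`, for every `M`; conversely a polynomial in `m_z
^ M O_z` already lies in `m_z ^ M`, by its order of vanishing. Surjectivity
(`exists_polynomial_sub_mem`) glues such polynomials by the Chinese remainder theorem. Injectivity
(`mem_polyIdeal_of_forall_polyGerm_mem`) replaces holomorphic coefficients by polynomial ones modulo
`m_z ^ (M + 1) O_z`.

Thus `f` has the same local classes as some polynomial `P`, and `α` must be the coordinate vector of
the class of `P` in the basis of standard monomials (`standardBasis`). -/

/-! ### Holomorphic parameter integrals and divided differences -/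

theorem stronglyMeasurable_fderiv_of_family {n : ℕ} {Φ : (Fin n → ℂ) → ℝ → ℂ}
    {U : Set (Fin n → ℂ)} (hU : IsOpen U) (hd : ∀ t, DifferentiableOn ℂ (Φ · t) U)
    (hc : ∀ s ∈ U, Continuous (Φ s)) {s : Fin n → ℂ} (hs : s ∈ U) :
    MeasureTheory.StronglyMeasurable fun t => fderiv ℂ (Φ · t) s := by
  have key : ∀ v, MeasureTheory.StronglyMeasurable fun t => fderiv ℂ (Φ · t) s v := by
    intro v
    have hc0 : Tendsto (fun k : ℕ => ‖(k : ℂ)‖) atTop atTop := by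
      simpa using tendsto_natCast_atTop_atTop (R := ℝ)
    have h1 : Tendsto (fun k : ℕ => s + (k : ℂ)⁻¹ • v) atTop (𝓝 s) := by
      have : Tendsto (fun k : ℕ => (k : ℂ)⁻¹) atTop (𝓝 0) := by
        simpa using tendsto_inv_atTop_nhds_zero_nat (𝕜 := ℂ)
      simpa using tendsto_const_nhds.add (this.smul_const v)
    obtain ⟨K, hK⟩ := eventually_atTop.1 (h1.eventually (hU.mem_nhds hs))
    -- A directional derivative is a limit of difference quotients, each continuous in `t`; the
    -- shift by `K` keeps every sample point inside `U`.
    refine stronglyMeasurable_of_tendsto atTop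
      (f := fun (k : ℕ) t => ((k + K : ℕ) : ℂ) •
        (Φ (s + ((k + K : ℕ) : ℂ)⁻¹ • v) t - Φ s t)) (fun k => ?_) ?_
    · simp only [smul_eq_mul]
      exact (continuous_const.mul
        ((hc _ (hK _ (Nat.le_add_left _ _))).sub (hc s hs))).stronglyMeasurable
    · refine tendsto_pi_nhds.2 fun t => ?_
      have := (((hd t).differentiableAt (hU.mem_nhds hs)).hasFDerivAt).lim v hc0
      exact this.comp (tendsto_add_atTop_nat K)
  have e : (fun t => fderiv ℂ (Φ · t) s) = fun t => ∑ i,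
      (fderiv ℂ (Φ · t) s (Pi.single i 1)) •
        (ContinuousLinearMap.proj (R := ℂ) (φ := fun _ : Fin n => ℂ) i) := by
    funext t
    ext v
    conv_lhs => rw [pi_eq_sum_univ' v, map_sum]
    simp [mul_comm]
  rw [e]
  refine Finset.stronglyMeasurable_fun_sum _ fun i _ => ?_
  exact (key _).smul_const _

theorem differentiableOn_intervalIntegral_of_bounded {n : ℕ} {Φ : (Fin n → ℂ) → ℝ → ℂ}
    {U : Set (Fin n → ℂ)} (hU : IsOpen U) {C : ℝ} (hd : ∀ t, DifferentiableOn ℂ (Φ · t) U)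
    (hC : ∀ s ∈ U, ∀ t, ‖Φ s t‖ ≤ C) (hc : ∀ s ∈ U, Continuous (Φ s)) (a b : ℝ) :
    DifferentiableOn ℂ (fun s => ∫ t in a..b, Φ s t) U := by
  intro s hs
  obtain ⟨ε, hε, hball⟩ := Metric.isOpen_iff.1 hU s hs
  -- The Schwarz lemma on `ball x (2 * ε / 3)`, with image in a ball of radius `2 * C`, gives the
  -- constant `3 * C / ε`; `6 * C / ε` leaves room. What matters is uniformity in `t`, which
  -- supplies the dominating function.
  have hlip : ∀ t, LipschitzOnWith (Real.nnabs (6 * C / ε)) (Φ · t) (ball s (ε / 3)) := by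
    intro t
    refine LipschitzOnWith.of_dist_le_mul fun y hy x hx => ?_
    have hsub : ball x (2 * ε / 3) ⊆ U := by
      refine Subset.trans (fun w hw => ?_) hball
      rw [mem_ball] at *
      linarith [dist_triangle w x s]
    have hC0 : 0 ≤ C := (norm_nonneg _).trans (hC s hs t)
    have hxU : x ∈ U := hsub (mem_ball_self (by positivity))
    have := Complex.dist_le_div_mul_dist_of_mapsTo_ball (R₂ := 2 * C) (z := y)
      ((hd t).mono hsub) (fun w hw => ?_) ?_
    · refine this.trans ?_
      gcongr
      rw [Real.coe_nnabs, abs_of_nonneg (by positivity), div_le_div_iff₀ (by positivity) hε]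
      nlinarith
    · rw [mem_closedBall, dist_eq_norm]
      refine (norm_sub_le _ _).trans ?_
      linarith [hC w (hsub hw) t, hC x hxU t]
    · rw [mem_ball] at *
      linarith [dist_triangle_right y x s]
  refine (intervalIntegral.hasFDerivAt_integral_of_dominated_loc_of_lip
    (F' := fun t => fderiv ℂ (Φ · t) s) (bound := fun _ => 6 * C / ε)
    (ball_mem_nhds s (by positivity : 0 < ε / 3)) ?_ ?_ ?_ ?_ ?_ ?_).2
      |>.differentiableAt.differentiableWithinAt
  · filter_upwards [hU.mem_nhds hs] with x hx
    exact (hc x hx).aestronglyMeasurable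
  · exact (hc s hs).intervalIntegrable _ _
  · exact (stronglyMeasurable_fderiv_of_family hU hd hc hs).aestronglyMeasurable
  · exact Eventually.of_forall fun t _ => hlip t
  · exact intervalIntegrable_const
  · exact Eventually.of_forall fun t _ => ((hd t).differentiableAt (hU.mem_nhds hs)).hasFDerivAt

theorem differentiable_update {n : ℕ} (i : Fin n) (w : ℂ) :
    Differentiable ℂ fun s : Fin n → ℂ => update s i w := by
  refine differentiable_pi.2 fun j => ?_
  rcases eq_or_ne j i with rfl | h
  · simp
  · simpa [h] using differentiable_apply j

theorem differentiable_update_right {n : ℕ} (i : Fin n) (s : Fin n → ℂ) :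
    Differentiable ℂ fun w : ℂ => update s i w := by
  refine differentiable_pi.2 fun j => ?_
  rcases eq_or_ne j i with rfl | h
  · simp
  · simp [h]

/-- Subtracting Cauchy's formulas at `s i` and `z i` in the `i`-th variable writes the slope as one
contour integral, which stays holomorphic across `s i = z i`. -/
theorem exists_differentiableOn_slope {n : ℕ} {f : (Fin n → ℂ) → ℂ} {z : Fin n → ℂ} {r : ℝ}
    (hr : 0 < r) (hf : DifferentiableOn ℂ f (ball z r)) (i : Fin n) :
    ∃ h : (Fin n → ℂ) → ℂ, DifferentiableOn ℂ h (ball z (r / 4)) ∧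
      ∀ s ∈ ball z (r / 4), f s - f (update s i (z i)) = (s i - z i) * h s := by
  have hup : ∀ s ∈ ball z (r / 4), ∀ w ∈ closedBall (z i) (r / 2),
      update s i w ∈ closedBall z (r / 2) := by
    intro s hs w hw
    simp only [mem_ball, mem_closedBall] at *
    rw [dist_pi_le_iff (by positivity)]
    rw [dist_pi_lt_iff (by positivity)] at hs
    intro j
    rcases eq_or_ne j i with rfl | h
    · simpa using hw
    · simpa [h] using (hs j).le.trans (by linarith)
  have hsub : closedBall z (r / 2) ⊆ ball z r := closedBall_subset_ball (by linarith)
  obtain ⟨C, hC⟩ := (isCompact_closedBall z (r / 2)).exists_bound_of_continuousOn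
    (hf.continuousOn.mono hsub)
  have hcoord : ∀ s ∈ ball z (r / 4), s i ∈ ball (z i) (r / 4) := fun s hs =>
    (dist_le_pi_dist s z i).trans_lt hs
  have hR0 : (0 : ℝ) ≤ r / 2 := by positivity
  have hne : ∀ s ∈ ball z (r / 4), ∀ w ∈ sphere (z i) (r / 2), r / 4 ≤ ‖w - s i‖ := by
    intro s hs w hw
    have h1 := hcoord s hs
    rw [mem_ball] at h1
    rw [mem_sphere] at hw
    rw [← dist_eq_norm]
    linarith [dist_triangle w (s i) (z i)]
  have hsl : ∀ s ∈ ball z (r / 4), DifferentiableOn ℂ (fun w => f (update s i w))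
      (closedBall (z i) (r / 2)) := fun s hs =>
    hf.comp (differentiable_update_right i s).differentiableOn
      (fun w hw => hsub (hup s hs w hw))
  set Φ : (Fin n → ℂ) → ℂ → ℂ := fun s w => (w - z i)⁻¹ * (w - s i)⁻¹ * f (update s i w) with hΦ
  have hne0 : ∀ s ∈ ball z (r / 4), ∀ w ∈ sphere (z i) (r / 2), w - s i ≠ 0 := fun s hs w hw =>
    norm_pos_iff.1 (lt_of_lt_of_le (by positivity) (hne s hs w hw))
  have hne1 : ∀ w ∈ sphere (z i) (r / 2), w - z i ≠ 0 := fun w hw =>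
    hne0 z (mem_ball_self (by positivity)) w hw
  have hΦc : ∀ s ∈ ball z (r / 4), ContinuousOn (Φ s) (sphere (z i) (r / 2)) := fun s hs =>
    ((ContinuousOn.inv₀ (by fun_prop) hne1).mul
      (ContinuousOn.inv₀ (by fun_prop) (hne0 s hs))).mul
      ((hsl s hs).continuousOn.mono sphere_subset_closedBall)
  refine ⟨fun s => (2 * Real.pi * Complex.I : ℂ)⁻¹ * ∮ w in C(z i, r / 2), Φ s w, ?_, ?_⟩
  · refine DifferentiableOn.const_mul ?_ _
    -- The circle has speed `r / 2`, each of the two kernel factors is at most `(r / 4)⁻¹`, and `C`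
    -- bounds `f` on the closed ball.
    refine differentiableOn_intervalIntegral_of_bounded (C := (r / 2) * ((r / 4)⁻¹ * (r / 4)⁻¹ * C))
      isOpen_ball ?_ ?_ ?_ _ _
    · intro t
      have hm := circleMap_mem_sphere (z i) hR0 t
      simp only [smul_eq_mul]
      refine DifferentiableOn.const_mul ?_ _
      refine DifferentiableOn.mul (DifferentiableOn.mul (differentiableOn_const _)
        (DifferentiableOn.inv ?_ fun s hs => hne0 s hs _ hm)) ?_
      · exact ((differentiable_const _).sub (differentiable_apply i)).differentiableOn
      · exact hf.comp (differentiable_update i _).differentiableOn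
          fun s hs => hsub (hup s hs _ (sphere_subset_closedBall hm))
    · intro s hs t
      have hm := circleMap_mem_sphere (z i) hR0 t
      rw [norm_smul, deriv_circleMap, norm_mul, norm_circleMap_zero, Complex.norm_I, mul_one,
        abs_of_nonneg hR0, hΦ]
      simp only [norm_mul, norm_inv]
      have h1 := hne s hs _ hm
      have h2 := hne z (mem_ball_self (by positivity)) _ hm
      have h3 := hC _ (hup s hs _ (sphere_subset_closedBall hm))
      gcongr
    · intro s hs
      have h1 : Continuous fun t => Φ s (circleMap (z i) (r / 2) t) :=
        (hΦc s hs).comp_continuous (continuous_circleMap _ _)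
          (fun t => circleMap_mem_sphere (z i) hR0 t)
      simp only [deriv_circleMap]
      exact ((continuous_circleMap 0 (r / 2)).mul continuous_const).smul h1
  · intro s hs
    have hsi : s i ∈ ball (z i) (r / 2) :=
      ball_subset_ball (by linarith) (hcoord s hs)
    have e1 := (hsl s hs).circleIntegral_sub_inv_smul hsi
    have e2 := (hsl s hs).circleIntegral_sub_inv_smul
      (mem_ball_self (by positivity) : z i ∈ ball (z i) (r / 2))
    have hcs := (hsl s hs).continuousOn.mono sphere_subset_closedBall
    have i1 : CircleIntegrable (fun w => (w - s i)⁻¹ • f (update s i w)) (z i) (r / 2) :=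
      ((ContinuousOn.inv₀ (by fun_prop) (hne0 s hs)).smul hcs).circleIntegrable hR0
    have i2 : CircleIntegrable (fun w => (w - z i)⁻¹ • f (update s i w)) (z i) (r / 2) :=
      ((ContinuousOn.inv₀ (by fun_prop) hne1).smul hcs).circleIntegrable hR0
    have e3 : (∮ w in C(z i, r / 2), (s i - z i) • Φ s w) =
        (2 * Real.pi * Complex.I : ℂ) * (f s - f (update s i (z i))) := by
      rw [smul_eq_mul] at e1 e2
      rw [mul_sub, ← e2]
      have : f s = f (update s i (s i)) := by rw [update_eq_self]
      rw [this, ← e1, ← circleIntegral.integral_sub i1 i2]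
      refine circleIntegral.integral_congr hR0 fun w hw => ?_
      have := hne0 s hs w hw
      have := hne1 w hw
      simp only [hΦ, smul_eq_mul]
      field_simp
      ring
    rw [circleIntegral.integral_smul, smul_eq_mul] at e3
    have hpi : (2 * Real.pi * Complex.I : ℂ) ≠ 0 := by simp [Real.pi_ne_zero]
    rw [mul_left_comm, e3, inv_mul_cancel_left₀ hpi]

/-! ### Germs of holomorphic functions and of polynomials -/

/-- The ring of germs at `z` of holomorphic functions. -/
def holGerm {n : ℕ} (z : Fin n → ℂ) : Subring (Germ (𝓝 z) ℂ) where
  carrier := {g | ∃ f : (Fin n → ℂ) → ℂ, (∀ᶠ s in 𝓝 z, DifferentiableAt ℂ f s) ∧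
    (f : Germ (𝓝 z) ℂ) = g}
  zero_mem' := ⟨0, by simp, rfl⟩
  one_mem' := ⟨1, Eventually.of_forall fun _ => differentiableAt_const _, rfl⟩
  add_mem' := by
    rintro _ _ ⟨f, hf, rfl⟩ ⟨g, hg, rfl⟩
    exact ⟨f + g, (hf.and hg).mono fun s h => h.1.add h.2, rfl⟩
  mul_mem' := by
    rintro _ _ ⟨f, hf, rfl⟩ ⟨g, hg, rfl⟩
    exact ⟨f * g, (hf.and hg).mono fun s h => h.1.mul h.2, rfl⟩
  neg_mem' := by
    rintro _ ⟨f, hf, rfl⟩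
    exact ⟨-f, hf.mono fun s h => h.neg, rfl⟩

/-- The holomorphic germ of a function that is holomorphic near `z`. -/
noncomputable def holGermOf {n : ℕ} {z : Fin n → ℂ} (f : (Fin n → ℂ) → ℂ)
    (hf : ∀ᶠ s in 𝓝 z, DifferentiableAt ℂ f s) : holGerm z :=
  ⟨f, f, hf, rfl⟩

theorem holGermOf_eq_iff {n : ℕ} {z : Fin n → ℂ} {f g : (Fin n → ℂ) → ℂ}
    {hf : ∀ᶠ s in 𝓝 z, DifferentiableAt ℂ f s} {hg : ∀ᶠ s in 𝓝 z, DifferentiableAt ℂ g s} :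
    holGermOf f hf = holGermOf g hg ↔ f =ᶠ[𝓝 z] g := by
  rw [Subtype.ext_iff]
  exact Germ.coe_eq

theorem exists_holGermOf_eq {n : ℕ} {z : Fin n → ℂ} (g : holGerm z) :
    ∃ f hf, holGermOf f hf = g := by
  obtain ⟨_, f, hf, rfl⟩ := g
  exact ⟨f, hf, rfl⟩

theorem differentiable_mvPolynomial_eval {n : ℕ} (P : MvPolynomial (Fin n) ℂ) :
    Differentiable ℂ fun s => MvPolynomial.eval s P := fun s =>
  (AnalyticOnNhd.eval_mvPolynomial (𝕜 := ℂ) P s (mem_univ s)).differentiableAt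

/-- The germ at `z` of a polynomial. -/
noncomputable def polyGerm {n : ℕ} (z : Fin n → ℂ) : MvPolynomial (Fin n) ℂ →+* holGerm z :=
  ((Germ.coeRingHom (𝓝 z)).comp (RingHom.pi fun s => MvPolynomial.eval s)).codRestrict _
    fun P => ⟨fun s => MvPolynomial.eval s P,
      Eventually.of_forall fun s => differentiable_mvPolynomial_eval P s, rfl⟩

theorem polyGerm_apply {n : ℕ} (z : Fin n → ℂ) (P : MvPolynomial (Fin n) ℂ) :
    polyGerm z P = holGermOf (fun s => MvPolynomial.eval s P)
      (Eventually.of_forall fun s => differentiable_mvPolynomial_eval P s) := rfl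

theorem holGermOf_sub {n : ℕ} {z : Fin n → ℂ} {f g : (Fin n → ℂ) → ℂ}
    (hf : ∀ᶠ s in 𝓝 z, DifferentiableAt ℂ f s) (hg : ∀ᶠ s in 𝓝 z, DifferentiableAt ℂ g s) :
    holGermOf f hf - holGermOf g hg =
      holGermOf (fun s => f s - g s) ((hf.and hg).mono fun _ h => h.1.sub h.2) := rfl

theorem holGermOf_mul {n : ℕ} {z : Fin n → ℂ} {f g : (Fin n → ℂ) → ℂ}
    (hf : ∀ᶠ s in 𝓝 z, DifferentiableAt ℂ f s) (hg : ∀ᶠ s in 𝓝 z, DifferentiableAt ℂ g s) :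
    holGermOf f hf * holGermOf g hg =
      holGermOf (fun s => f s * g s) ((hf.and hg).mono fun _ h => h.1.mul h.2) := rfl

/-- The maximal ideal of polynomials vanishing at `z`. -/
noncomputable abbrev pointIdeal {n : ℕ} (z : Fin n → ℂ) : Ideal (MvPolynomial (Fin n) ℂ) :=
  MvPolynomial.vanishingIdeal ℂ {z}

theorem mem_pointIdeal {n : ℕ} {z : Fin n → ℂ} {P : MvPolynomial (Fin n) ℂ} :
    P ∈ pointIdeal z ↔ MvPolynomial.eval z P = 0 := by
  simp [pointIdeal, MvPolynomial.aeval_eq_eval]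

/-! ### Approximation of germs by polynomials modulo powers of the maximal ideal -/

theorem exists_eventually_slope {n : ℕ} {f : (Fin n → ℂ) → ℂ} {z : Fin n → ℂ}
    (hf : ∀ᶠ s in 𝓝 z, DifferentiableAt ℂ f s) (i : Fin n) :
    ∃ h : (Fin n → ℂ) → ℂ, (∀ᶠ s in 𝓝 z, DifferentiableAt ℂ h s) ∧
      ∀ᶠ s in 𝓝 z, f s - f (update s i (z i)) = (s i - z i) * h s := by
  obtain ⟨r, hr, hball⟩ := Metric.eventually_nhds_iff_ball.1 hf
  obtain ⟨h, hd, he⟩ := exists_differentiableOn_slope hr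
    (fun s hs => (hball s hs).differentiableWithinAt) i
  have hm : ball z (r / 4) ∈ 𝓝 z := ball_mem_nhds _ (by positivity)
  refine ⟨h, ?_, eventually_of_mem hm he⟩
  filter_upwards [isOpen_ball.mem_nhds (mem_ball_self (by positivity : 0 < r / 4))] with s hs
  exact hd.differentiableAt (isOpen_ball.mem_nhds hs)

theorem tendsto_piecewise_nhds {n : ℕ} (z : Fin n → ℂ) (S : Finset (Fin n)) :
    Tendsto (fun s : Fin n → ℂ => S.piecewise z s) (𝓝 z) (𝓝 z) := by
  refine tendsto_pi_nhds.2 fun i => ?_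
  by_cases h : i ∈ S
  · simp [h]
  · simpa [h] using (continuous_apply i).tendsto z

theorem differentiable_piecewise {n : ℕ} (z : Fin n → ℂ) (S : Finset (Fin n)) :
    Differentiable ℂ (fun s : Fin n → ℂ => S.piecewise z s) := by
  refine differentiable_pi.2 fun i => ?_
  by_cases h : i ∈ S
  · simp [h]
  · simpa [h] using differentiable_apply i

theorem eventually_differentiableAt_piecewise {n : ℕ} {f : (Fin n → ℂ) → ℂ} {z : Fin n → ℂ}
    (hf : ∀ᶠ s in 𝓝 z, DifferentiableAt ℂ f s) (S : Finset (Fin n)) :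
    ∀ᶠ s in 𝓝 z, DifferentiableAt ℂ (fun s => f (S.piecewise z s)) s := by
  filter_upwards [(tendsto_piecewise_nhds z S).eventually hf] with s hs
  exact hs.comp s (differentiable_piecewise z S s)

/-- Freezing one more coordinate `i` at `z i` changes the function by `X i - C (z i)` times a
holomorphic slope. With all coordinates frozen, only the constant `f z` remains. -/
theorem holGermOf_sub_piecewise_mem {n : ℕ} {f : (Fin n → ℂ) → ℂ} {z : Fin n → ℂ}
    (hf : ∀ᶠ s in 𝓝 z, DifferentiableAt ℂ f s) (S : Finset (Fin n)) :
    holGermOf f hf - holGermOf _ (eventually_differentiableAt_piecewise hf S) ∈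
      (pointIdeal z).map (polyGerm z) := by
  induction S using Finset.induction_on with
  | empty =>
    have : holGermOf f hf = holGermOf _ (eventually_differentiableAt_piecewise hf ∅) :=
      holGermOf_eq_iff.2 (by simp)
    rw [← this, sub_self]
    exact zero_mem _
  | insert i S hi ih =>
    rw [← sub_add_sub_cancel _ (holGermOf _ (eventually_differentiableAt_piecewise hf S))]
    refine add_mem ih ?_
    obtain ⟨h, hd, he⟩ := exists_eventually_slope (eventually_differentiableAt_piecewise hf S) i
    have : holGermOf _ (eventually_differentiableAt_piecewise hf S) -
        holGermOf _ (eventually_differentiableAt_piecewise hf (insert i S)) =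
        polyGerm z (MvPolynomial.X i - MvPolynomial.C (z i)) * holGermOf h hd := by
      rw [polyGerm_apply, holGermOf_sub, holGermOf_mul, holGermOf_eq_iff]
      filter_upwards [he] with s hs
      simp only [map_sub, MvPolynomial.eval_X, MvPolynomial.eval_C]
      rw [← hs]
      congr 2
      ext j
      rcases eq_or_ne j i with rfl | hj
      · simp [hi]
      · by_cases hjS : j ∈ S <;> simp [hj, hjS]
    rw [this]
    refine Ideal.mul_mem_right _ _ (Ideal.mem_map_of_mem _ ?_)
    simp

theorem exists_sub_polyGerm_mem_map_pointIdeal {n : ℕ} {z : Fin n → ℂ} (g : holGerm z) :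
    ∃ T, g - polyGerm z T ∈ (pointIdeal z).map (polyGerm z) := by
  obtain ⟨f, hf, rfl⟩ := exists_holGermOf_eq g
  refine ⟨MvPolynomial.C (f z), ?_⟩
  convert holGermOf_sub_piecewise_mem hf Finset.univ using 2
  rw [polyGerm_apply, holGermOf_eq_iff]
  simp

/-- An element of `m ^ M S` is a combination of images of elements of `m ^ M`; approximating its
coefficients modulo `m S` leaves an error in `m ^ (M + 1) S`. -/
theorem exists_sub_mem_map_pow {R S : Type*} [CommRing R] [CommRing S] (φ : R →+* S) {m : Ideal R}
    (h : ∀ g, ∃ T, g - φ T ∈ m.map φ) (M : ℕ) (g : S) : ∃ T, g - φ T ∈ (m ^ M).map φ := by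
  induction M with
  | zero => exact ⟨0, by simp [Ideal.map_top, Ideal.one_eq_top]⟩
  | succ M ih =>
    have key : ∀ x ∈ (m ^ M).map φ, ∃ T ∈ m ^ M, x - φ T ∈ (m ^ (M + 1)).map φ := by
      intro x hx
      refine Submodule.span_induction (p := fun x _ => ∃ T ∈ m ^ M, x - φ T ∈ (m ^ (M + 1)).map φ)
        ?_ ?_ ?_ ?_ hx
      · rintro _ ⟨T, hT, rfl⟩
        exact ⟨T, hT, by simp⟩
      · exact ⟨0, zero_mem _, by simp⟩
      · rintro x y - - ⟨T, hT, hx⟩ ⟨T', hT', hy⟩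
        refine ⟨T + T', add_mem hT hT', ?_⟩
        rw [map_add, add_sub_add_comm]
        exact add_mem hx hy
      · rintro a x - ⟨T, hT, hx⟩
        obtain ⟨A, hA⟩ := h a
        refine ⟨A * T, Ideal.mul_mem_left _ _ hT, ?_⟩
        have : a • x - φ (A * T) = a * (x - φ T) + φ T * (a - φ A) := by
          rw [map_mul, smul_eq_mul]; ring
        rw [this]
        refine add_mem (Ideal.mul_mem_left _ _ hx) ?_
        rw [pow_succ, Ideal.map_mul]
        exact Ideal.mul_mem_mul (Ideal.mem_map_of_mem _ hT) hA
    obtain ⟨T, hT⟩ := ih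
    obtain ⟨T', -, hT'⟩ := key _ hT
    exact ⟨T + T', by rwa [map_add, ← sub_sub]⟩

/-! ### Order of vanishing, and the contraction of `m_z ^ M O_z` to polynomials -/

/-- The ideal of holomorphic germs vanishing to order at least `M` at `z`. -/
noncomputable def orderIdeal {n : ℕ} (z : Fin n → ℂ) (M : ℕ) : Ideal (holGerm z) where
  carrier := {g | ∃ f : (Fin n → ℂ) → ℂ, (f : Germ (𝓝 z) ℂ) = g ∧
    f =O[𝓝 z] fun s => ‖s - z‖ ^ M}
  zero_mem' := ⟨0, rfl, Asymptotics.isBigO_zero _ _⟩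
  add_mem' := by
    rintro ⟨_, _⟩ ⟨_, _⟩ ⟨f, rfl, hf⟩ ⟨g, rfl, hg⟩
    exact ⟨f + g, rfl, hf.add hg⟩
  smul_mem' := by
    rintro ⟨_, a, ha, rfl⟩ ⟨_, _⟩ ⟨g, rfl, hg⟩
    refine ⟨a * g, rfl, ?_⟩
    have h1 : a =O[𝓝 z] fun _ => (1 : ℝ) := ha.self_of_nhds.continuousAt.isBigO_one ℝ
    have h2 := h1.mul hg
    simp only [one_mul] at h2
    exact h2

theorem holGermOf_mem_orderIdeal {n : ℕ} {z : Fin n → ℂ} {M : ℕ} {f : (Fin n → ℂ) → ℂ}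
    {hf : ∀ᶠ s in 𝓝 z, DifferentiableAt ℂ f s} :
    holGermOf f hf ∈ orderIdeal z M ↔ f =O[𝓝 z] fun s => ‖s - z‖ ^ M := by
  constructor
  · rintro ⟨g, hg, hO⟩
    exact hO.congr' (Germ.coe_eq.1 hg) EventuallyEq.rfl
  · exact fun h => ⟨f, rfl, h⟩

theorem orderIdeal_mul_le {n : ℕ} (z : Fin n → ℂ) (M N : ℕ) :
    orderIdeal z M * orderIdeal z N ≤ orderIdeal z (M + N) := by
  refine Ideal.mul_le.2 ?_
  rintro ⟨_, _⟩ ⟨f, rfl, hf⟩ ⟨_, _⟩ ⟨g, rfl, hg⟩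
  refine ⟨f * g, rfl, ?_⟩
  simp only [pow_add]
  exact hf.mul hg

theorem map_pointIdeal_pow_le_orderIdeal {n : ℕ} (z : Fin n → ℂ) (M : ℕ) :
    (pointIdeal z ^ M).map (polyGerm z) ≤ orderIdeal z M := by
  induction M with
  | zero =>
    rintro g -
    obtain ⟨f, hf, rfl⟩ := exists_holGermOf_eq g
    rw [holGermOf_mem_orderIdeal]
    simpa using hf.self_of_nhds.continuousAt.isBigO_one ℝ
  | succ M ih =>
    rw [pow_succ, Ideal.map_mul]
    refine (Ideal.mul_mono ih (Ideal.map_le_iff_le_comap.2 fun P hP => ?_)).trans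
      (orderIdeal_mul_le z M 1)
    rw [Ideal.mem_comap, polyGerm_apply, holGermOf_mem_orderIdeal]
    rw [mem_pointIdeal] at hP
    simpa [hP] using (differentiable_mvPolynomial_eval P z).isBigO_sub.norm_right

theorem X_pow_dvd_of_isBigO (q : Polynomial ℂ) (M : ℕ)
    (h : (fun t => q.eval t) =O[𝓝 0] fun t : ℂ => t ^ M) : Polynomial.X ^ M ∣ q := by
  induction M with
  | zero => simp
  | succ M ih =>
    obtain ⟨u, rfl⟩ := ih (h.trans (Asymptotics.IsBigO.of_bound 1 (by
      filter_upwards [Metric.closedBall_mem_nhds (0 : ℂ) one_pos] with t ht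
      rw [mem_closedBall_zero_iff] at ht
      rw [pow_succ, norm_mul, one_mul]
      exact mul_le_of_le_one_right (norm_nonneg _) ht)))
    rw [pow_succ]
    refine mul_dvd_mul_left _ (Polynomial.X_dvd_iff.2 ?_)
    rw [Polynomial.coeff_zero_eq_eval_zero]
    obtain ⟨C, hC⟩ := h.bound
    have h1 : Tendsto (fun t => u.eval t) (𝓝[≠] 0) (𝓝 (u.eval 0)) :=
      u.continuous.continuousAt.tendsto.mono_left nhdsWithin_le_nhds
    refine tendsto_nhds_unique h1 (squeeze_zero_norm' (a := fun t => C * ‖t‖) ?_ ?_)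
    · filter_upwards [hC.filter_mono nhdsWithin_le_nhds, self_mem_nhdsWithin] with t ht ht0
      have : 0 < ‖t‖ ^ M := pow_pos (norm_pos_iff.2 ht0) _
      simp only [Polynomial.eval_mul, Polynomial.eval_pow, Polynomial.eval_X, norm_mul, norm_pow,
        pow_succ] at ht
      refine le_of_mul_le_mul_left ?_ this
      linarith
    · have : Tendsto (fun t : ℂ => C * ‖t‖) (𝓝 0) (𝓝 (C * ‖(0 : ℂ)‖)) :=
        (continuous_const.mul continuous_norm).tendsto 0
      simp only [norm_zero, mul_zero] at this
      exact this.mono_left nhdsWithin_le_nhds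

theorem eval_smul_eq_sum_homogeneousComponent {n : ℕ} (Q : MvPolynomial (Fin n) ℂ)
    (v : Fin n → ℂ) (t : ℂ) :
    MvPolynomial.eval (t • v) Q = (∑ d ∈ Finset.range (Q.totalDegree + 1),
      Polynomial.monomial d (MvPolynomial.eval v (Q.homogeneousComponent d))).eval t := by
  conv_lhs => rw [← MvPolynomial.sum_homogeneousComponent Q, map_sum]
  rw [Polynomial.eval_finsetSum]
  refine Finset.sum_congr rfl fun d _ => ?_
  rw [Polynomial.eval_monomial, mul_comm]
  rw [MvPolynomial.eval_eq', MvPolynomial.eval_eq', Finset.mul_sum]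
  refine Finset.sum_congr rfl fun x hx => ?_
  have hdeg : ∑ i, x i = d := by
    rw [← Finsupp.degree_eq_sum]
    by_contra hne
    rw [MvPolynomial.mem_support_iff, MvPolynomial.coeff_homogeneousComponent, if_neg hne] at hx
    exact hx rfl
  simp only [Pi.smul_apply, smul_eq_mul, mul_pow, Finset.prod_mul_distrib,
    Finset.prod_pow_eq_pow_sum, hdeg]
  ring

/-- On each line `t • v` the coefficient of `t ^ d` is the degree `d` component evaluated at `v`.
For `d < M` the growth bound kills it for every `v`, so the component itself is zero. -/
theorem mem_pow_idealOfVars_of_isBigO {n : ℕ} (Q : MvPolynomial (Fin n) ℂ) (M : ℕ)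
    (h : (fun s => MvPolynomial.eval s Q) =O[𝓝 0] fun s => ‖s‖ ^ M) :
    Q ∈ MvPolynomial.idealOfVars (Fin n) ℂ ^ M := by
  rw [MvPolynomial.mem_pow_idealOfVars_iff']
  intro x hx
  have hzero : Q.homogeneousComponent x.degree = 0 := by
    refine MvPolynomial.funext fun v => ?_
    have ht : Tendsto (fun t : ℂ => t • v) (𝓝 0) (𝓝 0) := by
      simpa using (by fun_prop : Continuous fun t : ℂ => t • v).tendsto 0
    have hO : (fun t => MvPolynomial.eval (t • v) Q) =O[𝓝 0] fun t : ℂ => t ^ M := by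
      refine (h.comp_tendsto ht).trans ?_
      refine Asymptotics.IsBigO.of_bound (‖v‖ ^ M) (Eventually.of_forall fun t => ?_)
      simp [norm_smul, mul_pow, mul_comm]
    simp only [eval_smul_eq_sum_homogeneousComponent] at hO
    have hd := Polynomial.X_pow_dvd_iff.1 (X_pow_dvd_of_isBigO _ M hO) _ hx
    rw [Polynomial.finsetSum_coeff] at hd
    simp only [Polynomial.coeff_monomial, Finset.sum_ite_eq', Finset.mem_range] at hd
    split_ifs at hd with hlt
    · simpa using hd
    · rw [MvPolynomial.homogeneousComponent_eq_zero _ _ (by omega)]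
  have := congrArg (MvPolynomial.coeff x) hzero
  simpa [MvPolynomial.coeff_homogeneousComponent] using this

theorem mem_pointIdeal_pow_of_polyGerm_mem {n : ℕ} {z : Fin n → ℂ} {M : ℕ}
    {Q : MvPolynomial (Fin n) ℂ} (h : polyGerm z Q ∈ (pointIdeal z ^ M).map (polyGerm z)) :
    Q ∈ pointIdeal z ^ M := by
  have h1 := map_pointIdeal_pow_le_orderIdeal z M h
  rw [polyGerm_apply, holGermOf_mem_orderIdeal] at h1
  -- `τ` translates `z` to the origin and `σ` translates back.
  let τ : MvPolynomial (Fin n) ℂ →ₐ[ℂ] MvPolynomial (Fin n) ℂ :=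
    MvPolynomial.aeval fun i => MvPolynomial.X i + MvPolynomial.C (z i)
  let σ : MvPolynomial (Fin n) ℂ →ₐ[ℂ] MvPolynomial (Fin n) ℂ :=
    MvPolynomial.aeval fun i => MvPolynomial.X i - MvPolynomial.C (z i)
  have hστ : σ (τ Q) = Q := by
    have : σ.comp τ = AlgHom.id ℂ _ := by
      ext i : 1
      simp [σ, τ, MvPolynomial.algHom_C]
    exact DFunLike.congr_fun this Q
  have hτ : ∀ s, MvPolynomial.eval s (τ Q) = MvPolynomial.eval (s + z) Q := by
    intro s
    have : (MvPolynomial.aeval s).comp τ = MvPolynomial.aeval (s + z) := by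
      ext i : 1
      simp [τ]
    exact DFunLike.congr_fun this Q
  have h2 : τ Q ∈ MvPolynomial.idealOfVars (Fin n) ℂ ^ M := by
    refine mem_pow_idealOfVars_of_isBigO _ M ?_
    have ht : Tendsto (fun s : Fin n → ℂ => s + z) (𝓝 0) (𝓝 z) := by
      simpa using (by fun_prop : Continuous fun s : Fin n → ℂ => s + z).tendsto 0
    simpa [hτ, Function.comp_def] using h1.comp_tendsto ht
  rw [← hστ]
  have h3 := Ideal.mem_map_of_mem σ h2
  rw [Ideal.map_pow] at h3
  refine Ideal.pow_right_mono ?_ M h3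
  rw [MvPolynomial.idealOfVars, Ideal.map_span, Ideal.span_le]
  rintro _ ⟨_, ⟨i, rfl⟩, rfl⟩
  simp [σ]

/-! ### Coprimality, the Nullstellensatz and localisation at the zeros -/

theorem isUnit_polyGerm {n : ℕ} {z : Fin n → ℂ} {P : MvPolynomial (Fin n) ℂ}
    (h : MvPolynomial.eval z P ≠ 0) : IsUnit (polyGerm z P) := by
  have hne : ∀ᶠ s in 𝓝 z, MvPolynomial.eval s P ≠ 0 :=
    (differentiable_mvPolynomial_eval P).continuous.continuousAt.eventually_ne h
  refine IsUnit.of_mul_eq_one (holGermOf (fun s => (MvPolynomial.eval s P)⁻¹)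
    (hne.mono fun s hs => (differentiable_mvPolynomial_eval P s).inv hs)) ?_
  rw [polyGerm_apply, holGermOf_mul]
  change _ = holGermOf (fun _ => 1) (Eventually.of_forall fun _ => differentiableAt_const _)
  rw [holGermOf_eq_iff]
  filter_upwards [hne] with s hs
  exact mul_inv_cancel₀ hs

theorem isCoprime_pointIdeal {n : ℕ} {z w : Fin n → ℂ} (h : z ≠ w) :
    IsCoprime (pointIdeal z) (pointIdeal w) := by
  refine Ideal.isCoprime_of_isMaximal fun he => ?_
  obtain ⟨i, hi⟩ := Function.ne_iff.1 h
  have h1 : MvPolynomial.X i - MvPolynomial.C (z i) ∈ pointIdeal w := by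
    rw [← he, mem_pointIdeal]; simp
  rw [mem_pointIdeal] at h1
  simp [sub_eq_zero] at h1
  exact hi h1.symm

theorem pairwise_isCoprime_pointIdeal_pow {n : ℕ} (Z : Set (Fin n → ℂ)) (M : ℕ) :
    Pairwise (IsCoprime on fun z : Z => pointIdeal z.1 ^ M) := fun _ _ h =>
  (isCoprime_pointIdeal fun h' => h (Subtype.ext h')).pow

theorem mem_ideal_of_forall_mem_sup {ι R : Type*} [CommRing R] [Finite ι] {J : ι → Ideal R}
    {I : Ideal R} (hJ : Pairwise (IsCoprime on J)) (hI : ⨅ i, J i ≤ I) {Q : R}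
    (h : ∀ i, Q ∈ I ⊔ J i) : Q ∈ I := by
  classical
  cases nonempty_fintype ι
  choose a ha b hb hab using fun i => Submodule.mem_sup.1 (h i)
  choose e he using fun i => Ideal.exists_forall_sub_mem_ideal hJ (Pi.single i 1)
  -- Modulo `J i` the sum reduces to `a i`, since `e j` is congruent to the Kronecker delta, and `Q
  -- - a i = b i` lies in `J i`.
  have hs : Q - ∑ j, e j * a j ∈ ⨅ i, J i := by
    refine (Submodule.mem_iInf _).2 fun i => ?_
    have h1 : Q - ∑ j, e j * a j = b i - ∑ j, (e j - Pi.single (M := fun _ => R) j 1 i) * a j := by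
      simp only [sub_mul, Finset.sum_sub_distrib, Pi.single_apply, ite_mul, one_mul, zero_mul,
        Finset.sum_ite_eq, Finset.mem_univ, if_true]
      rw [← hab i]; ring
    rw [h1]
    exact sub_mem (hb i) (sum_mem fun j _ => Ideal.mul_mem_right _ _ (he j i))
  have h2 : ∑ j, e j * a j ∈ I := sum_mem fun j _ => Ideal.mul_mem_left _ _ (ha j)
  simpa using add_mem (hI hs) h2

theorem mem_commonZeros_iff_forall_mem {n : ℕ} (p : Fin n → MvPolynomial (Fin n) ℂ)
    (z : Fin n → ℂ) : z ∈ commonZeros p ↔ ∀ P ∈ polyIdeal p, MvPolynomial.eval z P = 0 := by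
  constructor
  · intro hz P hP
    have : polyIdeal p ≤ RingHom.ker (MvPolynomial.eval z) :=
      Ideal.span_le.2 (by rintro _ ⟨j, rfl⟩; exact hz j)
    exact this hP
  · exact fun h j => h _ (Ideal.subset_span ⟨j, rfl⟩)

theorem vanishingIdeal_commonZeros {n : ℕ} (p : Fin n → MvPolynomial (Fin n) ℂ) :
    MvPolynomial.vanishingIdeal ℂ (commonZeros p) = (polyIdeal p).radical := by
  have : commonZeros p = MvPolynomial.zeroLocus ℂ (polyIdeal p) := by
    ext z
    simp [mem_commonZeros_iff_forall_mem, MvPolynomial.aeval_eq_eval]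
  rw [this, MvPolynomial.vanishingIdeal_zeroLocus_eq_radical]

/-- By coprimality the intersection is a power of `∏ m_z`, which lies in the radical of `(p)`; by
noetherianity a power of the radical lies in `(p)`. The exponent `M + 1` rather than `M` makes it
positive, so that congruences modulo these powers determine values at the zeros. -/
theorem exists_iInf_pointIdeal_pow_le {n : ℕ} {p : Fin n → MvPolynomial (Fin n) ℂ}
    (hfin : (commonZeros p).Finite) :
    ∃ M, ⨅ z : commonZeros p, pointIdeal z.1 ^ (M + 1) ≤ polyIdeal p := by
  have : Fintype (commonZeros p) := hfin.fintype
  obtain ⟨M, hM⟩ := (polyIdeal p).exists_radical_pow_le_of_fg (IsNoetherian.noetherian _)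
  refine ⟨M, ?_⟩
  have h1 := Ideal.prod_eq_iInf_of_pairwise_isCoprime (s := Finset.univ)
    (J := fun z : commonZeros p => pointIdeal z.1 ^ (M + 1))
    ((pairwise_isCoprime_pointIdeal_pow _ _).set_pairwise _)
  simp only [Finset.mem_univ, iInf_pos] at h1
  rw [← h1, Finset.prod_pow]
  refine (Ideal.pow_le_pow_right (Nat.le_succ M)).trans ((Ideal.pow_right_mono ?_ M).trans hM)
  rw [← vanishingIdeal_commonZeros]
  intro P hP z hz
  exact (Ideal.prod_le_inf.trans (Finset.inf_le (Finset.mem_univ (⟨z, hz⟩ : commonZeros p)))) hP z rfl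

theorem map_pointIdeal_pow_le {n : ℕ} {p : Fin n → MvPolynomial (Fin n) ℂ}
    (hfin : (commonZeros p).Finite) {M : ℕ}
    (hM : ⨅ z : commonZeros p, pointIdeal z.1 ^ (M + 1) ≤ polyIdeal p) {z : Fin n → ℂ}
    (hz : z ∈ commonZeros p) :
    (pointIdeal z ^ (M + 1)).map (polyGerm z) ≤ (polyIdeal p).map (polyGerm z) := by
  classical
  have : Finite (commonZeros p) := hfin
  -- `e` is `1` modulo the power at `z` and `0` modulo the powers at the other zeros. Hence `e * P`
  -- lies in all the powers, so in `(p)`, while `e` is invertible as a germ at `z` and can be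
  -- cancelled.
  obtain ⟨e, he⟩ := Ideal.exists_forall_sub_mem_ideal
    (pairwise_isCoprime_pointIdeal_pow (commonZeros p) (M + 1)) (Pi.single ⟨z, hz⟩ 1)
  have hez : MvPolynomial.eval z e ≠ 0 := by
    have h1 := mem_pointIdeal.1 (Ideal.pow_le_self M.succ_ne_zero (he ⟨z, hz⟩))
    simp only [Pi.single_eq_same, map_sub, map_one, sub_eq_zero] at h1
    simp [h1]
  refine Ideal.map_le_iff_le_comap.2 fun P hP => ?_
  rw [Ideal.mem_comap, ← Ideal.unit_mul_mem_iff_mem _ (isUnit_polyGerm hez), ← map_mul]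
  refine Ideal.mem_map_of_mem _ (hM ((Submodule.mem_iInf _).2 fun w => ?_))
  by_cases hw : w = ⟨z, hz⟩
  · subst hw
    exact Ideal.mul_mem_left _ _ hP
  · have := he w
    rw [Pi.single_eq_of_ne hw, sub_zero] at this
    exact Ideal.mul_mem_right _ _ this

/-! ### Comparison of `ℂ[s]/(p)` with the local quotients -/

/-- Truncating the holomorphic coefficients `c j` to polynomials `T j` leaves a polynomial error in
`m_z ^ (M + 1) O_z`, hence in `m_z ^ (M + 1)`. So `Q` lies in `(p) + m_z ^ (M + 1)` at every zero,
which suffices by coprimality. -/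
theorem mem_polyIdeal_of_forall_polyGerm_mem {n : ℕ} {p : Fin n → MvPolynomial (Fin n) ℂ}
    (hfin : (commonZeros p).Finite) {Q : MvPolynomial (Fin n) ℂ}
    (h : ∀ z ∈ commonZeros p, polyGerm z Q ∈ (polyIdeal p).map (polyGerm z)) :
    Q ∈ polyIdeal p := by
  have : Finite (commonZeros p) := hfin
  obtain ⟨M, hM⟩ := exists_iInf_pointIdeal_pow_le hfin
  refine mem_ideal_of_forall_mem_sup (pairwise_isCoprime_pointIdeal_pow _ _) hM fun z => ?_
  have hz := h z.1 z.2
  rw [polyIdeal, Ideal.map_span, ← range_comp, Ideal.mem_span_range_iff_exists_fun] at hz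
  obtain ⟨c, hc⟩ := hz
  choose T hT using fun j => exists_sub_mem_map_pow (polyGerm z.1)
    exists_sub_polyGerm_mem_map_pointIdeal (M + 1) (c j)
  have h1 : polyGerm z.1 (Q - ∑ j, T j * p j) ∈
      (pointIdeal z.1 ^ (M + 1)).map (polyGerm z.1) := by
    have : polyGerm z.1 (Q - ∑ j, T j * p j) =
        ∑ j, (c j - polyGerm z.1 (T j)) * polyGerm z.1 (p j) := by
      rw [map_sub, ← hc, map_sum, ← Finset.sum_sub_distrib]
      exact Finset.sum_congr rfl fun j _ => by rw [map_mul, sub_mul, comp_apply]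
    rw [this]
    exact sum_mem fun j _ => Ideal.mul_mem_right _ _ (hT j)
  refine Submodule.mem_sup.2 ⟨∑ j, T j * p j, sum_mem fun j _ => Ideal.mul_mem_left _ _
    (Ideal.subset_span ⟨j, rfl⟩), _, mem_pointIdeal_pow_of_polyGerm_mem h1, by ring⟩

theorem exists_polynomial_sub_mem {n : ℕ} {p : Fin n → MvPolynomial (Fin n) ℂ}
    (hfin : (commonZeros p).Finite) (g : ∀ z : commonZeros p, holGerm z.1) :
    ∃ P, ∀ z, g z - polyGerm z.1 P ∈ (polyIdeal p).map (polyGerm z.1) := by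
  have : Finite (commonZeros p) := hfin
  obtain ⟨M, hM⟩ := exists_iInf_pointIdeal_pow_le hfin
  choose T hT using fun z => exists_sub_mem_map_pow (polyGerm z.1)
    exists_sub_polyGerm_mem_map_pointIdeal (M + 1) (g z)
  obtain ⟨P, hP⟩ := Ideal.exists_forall_sub_mem_ideal
    (pairwise_isCoprime_pointIdeal_pow (commonZeros p) (M + 1)) T
  refine ⟨P, fun z => map_pointIdeal_pow_le hfin hM z.2 ?_⟩
  rw [← sub_sub_sub_cancel_right _ _ (polyGerm z.1 (T z)), ← map_sub]
  exact sub_mem (hT z) (Ideal.mem_map_of_mem _ (hP z))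

theorem belongsLocally_iff {n : ℕ} {p : Fin n → MvPolynomial (Fin n) ℂ} {U : Set (Fin n → ℂ)}
    (hU : IsOpen U) (hZ : commonZeros p ⊆ U) {h : (Fin n → ℂ) → ℂ} (hd : DifferentiableOn ℂ h U) :
    BelongsLocally p U h ↔ ∀ z (hz : z ∈ commonZeros p),
      holGermOf h (hd.eventually_differentiableAt (hU.mem_nhds (hZ hz))) ∈
        (polyIdeal p).map (polyGerm z) := by
  constructor
  · rintro ⟨-, hloc⟩ z hz
    obtain ⟨V, hV, hzV, -, g, hg, he⟩ := hloc z (hZ hz)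
    rw [polyIdeal, Ideal.map_span, ← range_comp, Ideal.mem_span_range_iff_exists_fun]
    refine ⟨fun j => holGermOf (g j) ((hg j).eventually_differentiableAt (hV.mem_nhds hzV)), ?_⟩
    refine Subtype.ext ?_
    rw [AddSubmonoidClass.coe_finsetSum]
    change ∑ j, ((fun s => g j s * MvPolynomial.eval s (p j) : (Fin n → ℂ) → ℂ) :
      Germ (𝓝 z) ℂ) = (h : Germ (𝓝 z) ℂ)
    change ∑ j, Germ.coeRingHom (𝓝 z) (fun s => g j s * MvPolynomial.eval s (p j)) = _
    rw [← map_sum]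
    refine Germ.coe_eq.2 ?_
    filter_upwards [hV.mem_nhds hzV] with s hs
    simp [he s hs]
  · refine fun H => ⟨hd, fun z hz => ?_⟩
    have hmem : holGermOf h (hd.eventually_differentiableAt (hU.mem_nhds hz)) ∈
        (polyIdeal p).map (polyGerm z) := by
      -- Off the common zeros some `p j` is a unit germ, so the ideal is everything.
      by_cases hz0 : z ∈ commonZeros p
      · exact H z hz0
      · simp only [commonZeros, mem_ofPred_eq, not_forall] at hz0
        obtain ⟨j, hj⟩ := hz0
        have hpj : p j ∈ polyIdeal p := Ideal.subset_span ⟨j, rfl⟩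
        rw [Ideal.eq_top_of_isUnit_mem _ (Ideal.mem_map_of_mem (polyGerm z) hpj)
          (isUnit_polyGerm hj)]
        trivial
    rw [polyIdeal, Ideal.map_span, ← range_comp, Ideal.mem_span_range_iff_exists_fun] at hmem
    obtain ⟨c, hc⟩ := hmem
    choose g hg hgc using fun j => exists_holGermOf_eq (c j)
    have hc' := congrArg Subtype.val hc
    rw [AddSubmonoidClass.coe_finsetSum] at hc'
    have he : ∀ᶠ s in 𝓝 z, h s = ∑ j, g j s * MvPolynomial.eval s (p j) := by
      have : Germ.coeRingHom (𝓝 z) (∑ j, fun s => g j s * MvPolynomial.eval s (p j)) =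
          (h : Germ (𝓝 z) ℂ) := by
        rw [map_sum]
        refine Eq.trans (Finset.sum_congr rfl fun j _ => ?_) hc'
        rw [← hgc j]
        rfl
      filter_upwards [Germ.coe_eq.1 this] with s hs
      simpa using hs.symm
    obtain ⟨V, hVs, hV, hzV⟩ := _root_.eventually_nhds_iff.1
      ((he.and (eventually_all.2 hg)).and (hU.mem_nhds hz))
    exact ⟨V, hV, hzV, fun s hs => (hVs s hs).2, g,
      fun j s hs => ((hVs s hs).1.2 j).differentiableWithinAt, fun s hs => (hVs s hs).1.1⟩

/-! ### Finiteness of the quotient and the Gröbner monomial basis -/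

theorem finite_quotient_polyIdeal {n : ℕ} {p : Fin n → MvPolynomial (Fin n) ℂ}
    (hfin : (commonZeros p).Finite) :
    Module.Finite ℂ (MvPolynomial (Fin n) ℂ ⧸ polyIdeal p) := by
  have hint : ∀ i, IsIntegral ℂ (Ideal.Quotient.mkₐ ℂ (polyIdeal p) (MvPolynomial.X i)) := by
    intro i
    -- `q` has the `i`-th coordinates of all the zeros as roots, so `q` evaluated at `X i` vanishes
    -- on the zero set and a power of it lies in `(p)`: a monic equation for the class of `X i`.
    let q : Polynomial ℂ := ∏ z ∈ hfin.toFinset, (Polynomial.X - Polynomial.C (z i))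
    have hq : q.Monic := Polynomial.monic_prod_of_monic _ _ fun z _ => Polynomial.monic_X_sub_C _
    have hrad : Polynomial.aeval (MvPolynomial.X i) q ∈ (polyIdeal p).radical := by
      rw [← vanishingIdeal_commonZeros]
      intro z hz
      rw [← Polynomial.aeval_algHom_apply, MvPolynomial.aeval_X, map_prod]
      exact Finset.prod_eq_zero (hfin.mem_toFinset.2 hz) (by simp)
    obtain ⟨k, hk⟩ := hrad
    refine ⟨q ^ k, hq.pow k, ?_⟩
    rw [← Polynomial.aeval_def, Polynomial.aeval_algHom_apply, map_pow]
    exact Ideal.Quotient.eq_zero_iff_mem.2 hk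
  have htop : Algebra.adjoin ℂ (range fun i => Ideal.Quotient.mkₐ ℂ (polyIdeal p)
      (MvPolynomial.X i)) = ⊤ := by
    rw [range_comp' (Ideal.Quotient.mkₐ ℂ (polyIdeal p)) MvPolynomial.X, ← AlgHom.map_adjoin,
      MvPolynomial.adjoin_range_X, Algebra.map_top, AlgHom.range_eq_top]
    exact Ideal.Quotient.mkₐ_surjective _ _
  have := Algebra.finite_adjoin_of_finite_of_isIntegral (R := ℂ) (finite_range fun i =>
    Ideal.Quotient.mkₐ ℂ (polyIdeal p) (MvPolynomial.X i)) (by rintro _ ⟨i, rfl⟩; exact hint i)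
  rw [htop] at this
  exact Module.Finite.equiv Subalgebra.topEquiv.toLinearEquiv

/-- The condition `g ≠ 0` is essential: `m.degree 0 = 0` lies below every exponent, although the
zero polynomial contributes nothing to the leading ideal. -/
theorem mem_standardExponents_iff {n : ℕ} {m : MonomialOrder (Fin n)}
    {G : Finset (MvPolynomial (Fin n) ℂ)} {b : Fin n →₀ ℕ} :
    b ∈ standardExponents m G ↔ ∀ g ∈ G, g ≠ 0 → ¬ m.degree g ≤ b := by
  have h := MvPolynomial.mem_ideal_span_monomial_image (R := ℂ) (x := MvPolynomial.monomial b 1)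
    (s := m.degree '' ((G : Set (MvPolynomial (Fin n) ℂ)) \ {0}))
  rw [image_image, ← m.span_leadingTerm_eq_span_monomial'] at h
  rw [standardExponents, mem_ofPred_eq, h]
  simp [MvPolynomial.support_monomial]

theorem mk_eq_zero_of_support_subset {n : ℕ} {m : MonomialOrder (Fin n)}
    {I : Ideal (MvPolynomial (Fin n) ℂ)} {G : Finset (MvPolynomial (Fin n) ℂ)}
    (hG : IsGroebnerBasis m I G) {r : MvPolynomial (Fin n) ℂ} (hr : r ∈ I)
    (hs : (r.support : Set (Fin n →₀ ℕ)) ⊆ standardExponents m G) : r = 0 := by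
  by_contra h0
  refine hs (m.degree_mem_support h0) ?_
  have h1 : m.leadingTerm r ∈ Ideal.span (m.leadingTerm '' (G : Set (MvPolynomial (Fin n) ℂ))) := by
    rw [hG.2]
    exact Ideal.subset_span ⟨r, hr, rfl⟩
  have h2 := Ideal.mul_mem_left _ (MvPolynomial.C (m.leadingCoeff r)⁻¹) h1
  rwa [MonomialOrder.leadingTerm, MvPolynomial.C_mul_monomial,
    inv_mul_cancel₀ (m.leadingCoeff_ne_zero_iff.2 h0)] at h2

theorem exists_remainder {n : ℕ} {m : MonomialOrder (Fin n)}
    {I : Ideal (MvPolynomial (Fin n) ℂ)} {G : Finset (MvPolynomial (Fin n) ℂ)}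
    (hG : IsGroebnerBasis m I G) (f : MvPolynomial (Fin n) ℂ) :
    ∃ r, f - r ∈ I ∧ (r.support : Set (Fin n →₀ ℕ)) ⊆ standardExponents m G := by
  obtain ⟨g, r, hf, -, hr⟩ := m.div_set (B := (G : Set (MvPolynomial (Fin n) ℂ)) \ {0})
    (fun b hb => isUnit_iff_ne_zero.2 (m.leadingCoeff_ne_zero_iff.2 hb.2)) f
  refine ⟨r, ?_, fun c hc => mem_standardExponents_iff.2 fun b hb hb0 => hr c hc b ⟨hb, hb0⟩⟩
  rw [hf, add_sub_cancel_right, Finsupp.linearCombination_apply]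
  exact sum_mem fun b _ => Ideal.mul_mem_left _ _ (hG.1 _ b.2.1)

/-- The classes of the standard monomials form a basis of the quotient ring. -/
noncomputable def standardBasis {n : ℕ} {m : MonomialOrder (Fin n)}
    {I : Ideal (MvPolynomial (Fin n) ℂ)} {G : Finset (MvPolynomial (Fin n) ℂ)}
    (hG : IsGroebnerBasis m I G) :
    Module.Basis (standardExponents m G) ℂ (MvPolynomial (Fin n) ℂ ⧸ I) :=
  Module.Basis.mk (v := fun b => Ideal.Quotient.mkₐ ℂ I (MvPolynomial.monomial b.1 1))
    (by
      -- Independence survives in the quotient because a combination of standard monomials that lies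
      -- in `I` is zero.
      refine (((MvPolynomial.basisMonomials (Fin n) ℂ).linearIndependent.comp _
        Subtype.val_injective).map (f := (Ideal.Quotient.mkₐ ℂ I).toLinearMap) ?_)
      rw [Submodule.disjoint_def]
      intro r hr hker
      refine mk_eq_zero_of_support_subset hG (Ideal.Quotient.eq_zero_iff_mem.1 hker) ?_
      rw [← MvPolynomial.mem_restrictSupport_iff (R := ℂ)]
      refine Submodule.span_le.2 ?_ hr
      rintro _ ⟨b, rfl⟩
      simp [MvPolynomial.mem_restrictSupport_iff, MvPolynomial.support_monomial])
    (by
      rintro x -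
      obtain ⟨f, rfl⟩ := Ideal.Quotient.mkₐ_surjective ℂ I x
      obtain ⟨r, hfr, hr⟩ := exists_remainder hG f
      have h1 : Ideal.Quotient.mkₐ ℂ I f = Ideal.Quotient.mkₐ ℂ I r := Ideal.Quotient.eq.2 hfr
      rw [h1, r.as_sum, map_sum]
      refine sum_mem fun c hc => ?_
      rw [← mul_one (MvPolynomial.coeff c r), ← smul_eq_mul, ← MvPolynomial.smul_monomial,
        map_smul]
      exact Submodule.smul_mem _ _ (Submodule.subset_span ⟨⟨c, hr hc⟩, rfl⟩))

theorem standardBasis_apply {n : ℕ} {m : MonomialOrder (Fin n)}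
    {I : Ideal (MvPolynomial (Fin n) ℂ)} {G : Finset (MvPolynomial (Fin n) ℂ)}
    (hG : IsGroebnerBasis m I G) (b : standardExponents m G) :
    standardBasis hG b = Ideal.Quotient.mk I (MvPolynomial.monomial b.1 1) := by
  simp [standardBasis]

theorem mainTheorem2 {n : ℕ} (p : Fin n → MvPolynomial (Fin n) ℂ)
    (hne : (commonZeros p).Nonempty) (hfin : (commonZeros p).Finite)
    (m : MonomialOrder (Fin n)) (G : Finset (MvPolynomial (Fin n) ℂ))
    (hG : IsGroebnerBasis m (polyIdeal p) G) :
    ((standardExponents m G).Finite ∧ (standardExponents m G).ncard = quotientDim p) ∧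
    ∀ β : Fin (quotientDim p) → (Fin n →₀ ℕ),
      Function.Injective β → Set.range β = standardExponents m G →
      ∀ U : Set (Fin n → ℂ), IsOpen U → commonZeros p ⊆ U →
      ∀ f : (Fin n → ℂ) → ℂ, DifferentiableOn ℂ f U →
        ∃! α : Fin (quotientDim p) → ℂ,
          BelongsLocally p U (fun s => f s - ∑ k, α k * ∏ i, s i ^ (β k i)) := by
  have := finite_quotient_polyIdeal hfin
  refine ⟨⟨Module.Finite.finite_basis (standardBasis hG), ?_⟩, ?_⟩
  · rw [quotientDim, Module.finrank_eq_nat_card_basis (standardBasis hG)]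
    rfl
  intro β hβ hrange U hU hZ f hf
  let B := (standardBasis hG).reindex
    ((Equiv.ofInjective β hβ).trans (Equiv.setCongr hrange)).symm
  have hB : ∀ k, B k = Ideal.Quotient.mk _ (MvPolynomial.monomial (β k) 1) := fun k => by
    simp [B, standardBasis_apply]
  let Q : (Fin (quotientDim p) → ℂ) → MvPolynomial (Fin n) ℂ := fun α =>
    ∑ k, MvPolynomial.monomial (β k) (α k)
  have hQB : ∀ α, Ideal.Quotient.mk (polyIdeal p) (Q α) = ∑ k, α k • B k := by
    intro α
    rw [map_sum]
    refine Finset.sum_congr rfl fun k _ => ?_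
    rw [hB, ← mul_one (α k), ← smul_eq_mul, ← MvPolynomial.smul_monomial, smul_eq_mul, mul_one]
    exact map_smul (Ideal.Quotient.mkₐ ℂ (polyIdeal p)) _ _
  have hQe : ∀ α s, MvPolynomial.eval s (Q α) = ∑ k, α k * ∏ i, s i ^ (β k i) := by
    intro α s
    simp [Q, MvPolynomial.eval_monomial, Finsupp.prod_fintype]
  -- A single polynomial `P` represents `f` modulo `(p)` at all zeros at once; both existence and
  -- uniqueness of `α` reduce to the class of `P`.
  obtain ⟨P, hP⟩ := exists_polynomial_sub_mem hfin fun z =>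
    holGermOf f (hf.eventually_differentiableAt (hU.mem_nhds (hZ z.2)))
  have hiff : ∀ α, BelongsLocally p U (fun s => f s - ∑ k, α k * ∏ i, s i ^ (β k i)) ↔
      P - Q α ∈ polyIdeal p := by
    intro α
    simp only [← hQe]
    have hd : DifferentiableOn ℂ (fun s => f s - MvPolynomial.eval s (Q α)) U :=
      hf.sub (differentiable_mvPolynomial_eval (Q α)).differentiableOn
    rw [belongsLocally_iff hU hZ hd]
    have hz : ∀ z (hz : z ∈ commonZeros p),
        holGermOf (fun s => f s - MvPolynomial.eval s (Q α))
          (hd.eventually_differentiableAt (hU.mem_nhds (hZ hz))) ∈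
          (polyIdeal p).map (polyGerm z) ↔
        polyGerm z (P - Q α) ∈ (polyIdeal p).map (polyGerm z) := by
      intro z hz
      rw [← Ideal.add_mem_iff_right _ (hP ⟨z, hz⟩) (b := polyGerm z (P - Q α)), map_sub,
        sub_add_sub_cancel, polyGerm_apply z (Q α), holGermOf_sub]
    constructor
    · exact fun h => mem_polyIdeal_of_forall_polyGerm_mem hfin fun z hzz => (hz z hzz).1 (h z hzz)
    · exact fun h z hzz => (hz z hzz).2 (Ideal.mem_map_of_mem _ h)
  have hiff' : ∀ α, BelongsLocally p U (fun s => f s - ∑ k, α k * ∏ i, s i ^ (β k i)) ↔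
      α = B.equivFun (Ideal.Quotient.mk _ P) := by
    intro α
    rw [hiff, ← Ideal.Quotient.eq, hQB, ← B.equivFun_symm_apply, LinearEquiv.eq_symm_apply]
    exact eq_comm
  exact ⟨_, (hiff' _).2 rfl, fun α hα => (hiff' α).1 hα⟩
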